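/- Let $R$ be a coherent ring, i.e. a ring such that the category of finitely presented right $R$-modules and the category of finitely presented left $R$-modules are both abelian. Let $\mathrm{Mod}(R)$ be the category of right $R$-modules and $\mathrm{Ab}$ the category of abelian groups; all functors are covariant and additive. Definitions. For $X\in\mathrm{Mod}(R)$ choose exact sequences $0\to\Omega X\to P\to X\to 0$ and $0\to X\to I\to\Sigma X\to 0$ with $P$ projective and $I$ injective. The satellites of a functor $F:\mathrm{Mod}(R)\to\mathrm{Ab}$ are $S_1F(X)=\ker\big(F(\Omega X)\to F(P)\big)$ and $S^1F(X)=\mathrm{coker}\big(F(I)\to F(\Sigma X)\big)$, with $S_0F=S^0F=F$, $S_{n+1}F=S_1(S_nF)$ and $S^{n+1}F=S^1(S^nF)$. The functor $F$ is projectively stable if the canonical map from $F$ to the cokernel of $L_0F\to F$ is an isomorphism, and injectively stable if the canonical map from the kernel of $F\to R^0F$ to $F$ is an isomorphism. It is half exact if $F(X)\to F(Y)\to F(Z)$ is exact for every short exact sequence $0\to X\to Y\to Z\to 0$. A half exact functor $F$ has $G$-dimension zero if all its satellites $S^nF$ and $S_nF$, $n\ge 0$ (so including $F$ itself), are both projectively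 and injectively stable. A module $M\in\mathrm{Mod}(R)$ has $G$-dimension zero if the functor $\underline{\mathrm{Hom}}(M,-)=\mathrm{Hom}(M,-)/\mathcal P(M,-)$ has $G$-dimension zero, where $\mathcal P(M,Y)$ is the group of morphisms $M\to Y$ that factor through a projective module. A functor $F$ is totally finitely presented if there are finitely presented modules $X,Y\in\mathrm{Mod}(R)$ and an exact sequence of functors $\mathrm{Hom}(Y,-)\to\mathrm{Hom}(X,-)\to F\to 0$. Theorem. Let $F:\mathrm{Mod}(R)\to\mathrm{Ab}$ be a half exact totally finitely presented functor. Then $F$ has $G$-dimension zero if and only if there is a module $M\in\mathrm{Mod}(R)$ of $G$-dimension zero (not assumed to be finitely presented) such that $F$ is naturally isomorphic to $\mathrm{Ext}^1(M,-)$. -/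

import Mathlib

open CategoryTheory CategoryTheory.Limits

universe u v₁ v₂ u₁ u₂

set_option linter.unusedSectionVars false

noncomputable section

namespace FunctorLinkage

open scoped ZeroObject

variable {C : Type u₁} [Category.{v₁} C] [Abelian C]
variable {D : Type u₂} [Category.{v₂} D] [Abelian D]

/-! ### Syzygies and cosyzygies -/

section Syzygy

variable [EnoughProjectives C]

/-- The syzygy `ΩX` in the chosen syzygy sequence `0 ⟶ ΩX ⟶ P ⟶ X ⟶ 0`. -/
abbrev omega (X : C) : C := kernel (Projective.π X)

/-- The inclusion `ΩX ⟶ P`. -/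
abbrev omegaι (X : C) : omega X ⟶ Projective.over X := kernel.ι (Projective.π X)

/-- A lift of `f : X ⟶ Y` to the projectives of the chosen syzygy sequences. -/
def overMap {X Y : C} (f : X ⟶ Y) : Projective.over X ⟶ Projective.over Y :=
  Projective.factorThru (Projective.π X ≫ f) (Projective.π Y)

lemma overMap_π {X Y : C} (f : X ⟶ Y) :
    overMap f ≫ Projective.π Y = Projective.π X ≫ f :=
  Projective.factorThru_comp _ _

/-- The morphism `ΩX ⟶ ΩY` induced by the chosen lift of `f : X ⟶ Y`. -/
def omegaMap {X Y : C} (f : X ⟶ Y) : omega X ⟶ omega Y :=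
  kernel.map _ _ (overMap f) f (overMap_π f).symm

lemma omegaMap_ι {X Y : C} (f : X ⟶ Y) :
    omegaMap f ≫ omegaι Y = omegaι X ≫ overMap f := by
  simp [omegaMap]

end Syzygy

section Cosyzygy

variable [EnoughInjectives C]

/-- The cosyzygy `ΣX` in the chosen cosyzygy sequence `0 ⟶ X ⟶ I ⟶ ΣX ⟶ 0`. -/
abbrev sigma (X : C) : C := cokernel (Injective.ι X)

/-- The projection `I ⟶ ΣX`. -/
abbrev sigmaπ (X : C) : Injective.under X ⟶ sigma X := cokernel.π (Injective.ι X)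

/-- An extension of `f : X ⟶ Y` to the injectives of the chosen cosyzygy sequences. -/
def underMap {X Y : C} (f : X ⟶ Y) : Injective.under X ⟶ Injective.under Y :=
  Injective.factorThru (f ≫ Injective.ι Y) (Injective.ι X)

lemma ι_underMap {X Y : C} (f : X ⟶ Y) :
    Injective.ι X ≫ underMap f = f ≫ Injective.ι Y :=
  Injective.comp_factorThru _ _

/-- The morphism `ΣX ⟶ ΣY` induced by the chosen extension of `f : X ⟶ Y`. -/
def sigmaMap {X Y : C} (f : X ⟶ Y) : sigma X ⟶ sigma Y :=
  cokernel.map _ _ f (underMap f) (ι_underMap f)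

lemma π_sigmaMap {X Y : C} (f : X ⟶ Y) :
    sigmaπ X ≫ sigmaMap f = underMap f ≫ sigmaπ Y := by
  simp [sigmaMap]

end Cosyzygy

/-! ### The left satellite `S₁F` -/

section LeftSatellite

variable [EnoughProjectives C]

/-- `F(ΩX) ⟶ F(ΩY)`, restricted to the kernel of `F(ΩX) ⟶ F(P)`, does not depend on the choice
of lift. -/
lemma kernel_ι_map_eq (F : C ⥤ D) [F.Additive] {X Y : C}
    (p p' : Projective.over X ⟶ Projective.over Y) (k k' : omega X ⟶ omega Y)
    (h : p ≫ Projective.π Y = p' ≫ Projective.π Y)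
    (hk : k ≫ omegaι Y = omegaι X ≫ p) (hk' : k' ≫ omegaι Y = omegaι X ≫ p') :
    kernel.ι (F.map (omegaι X)) ≫ F.map k = kernel.ι (F.map (omegaι X)) ≫ F.map k' := by
  have hs : (p - p') ≫ Projective.π Y = 0 := by rw [Preadditive.sub_comp, h, sub_self]
  have hkk : k - k' = omegaι X ≫ kernel.lift _ (p - p') hs := by
    rw [← cancel_mono (omegaι Y), Category.assoc, kernel.lift_ι, Preadditive.sub_comp, hk, hk',
      Preadditive.comp_sub]
  rw [← sub_eq_zero, ← Preadditive.comp_sub, ← F.map_sub, hkk, F.map_comp,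
    kernel.condition_assoc, zero_comp]

/-- The morphism `S₁F(X) ⟶ S₁F(Y)` induced by `f : X ⟶ Y`. -/
def leftSatelliteMap (F : C ⥤ D) [F.Additive] {X Y : C} (f : X ⟶ Y) :
    kernel (F.map (omegaι X)) ⟶ kernel (F.map (omegaι Y)) :=
  kernel.map _ _ (F.map (omegaMap f)) (F.map (overMap f))
    (by rw [← F.map_comp, ← F.map_comp, omegaMap_ι])

/-- The map on left satellites may be computed with any lift of `f`. -/
lemma leftSatelliteMap_ι (F : C ⥤ D) [F.Additive] {X Y : C} (f : X ⟶ Y)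
    (p : Projective.over X ⟶ Projective.over Y) (k : omega X ⟶ omega Y)
    (hp : p ≫ Projective.π Y = Projective.π X ≫ f) (hk : k ≫ omegaι Y = omegaι X ≫ p) :
    leftSatelliteMap F f ≫ kernel.ι (F.map (omegaι Y)) =
      kernel.ι (F.map (omegaι X)) ≫ F.map k := by
  simp only [leftSatelliteMap, kernel.map, kernel.lift_ι]
  exact kernel_ι_map_eq F _ p _ k (by rw [overMap_π, hp]) (omegaMap_ι f) hk

/-- The left satellite of an additive functor, `S₁F(X) = ker (F(ΩX) ⟶ F(P))`. -/
def leftSatelliteFunctor (F : C ⥤ D) [F.Additive] : C ⥤ D where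
  obj X := kernel (F.map (omegaι X))
  map f := leftSatelliteMap F f
  map_id X := by
    rw [← cancel_mono (kernel.ι _), leftSatelliteMap_ι F _ (𝟙 _) (𝟙 _) (by simp) (by simp)]
    simp
  map_comp {X Y Z} f g := by
    rw [← cancel_mono (kernel.ι _), Category.assoc,
      leftSatelliteMap_ι F g _ _ (overMap_π g) (omegaMap_ι g),
      reassoc_of% leftSatelliteMap_ι F f _ _ (overMap_π f) (omegaMap_ι f), ← F.map_comp]
    refine leftSatelliteMap_ι F _ (overMap f ≫ overMap g) _ ?_ ?_
    · rw [Category.assoc, overMap_π, reassoc_of% overMap_π f]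
    · rw [Category.assoc, omegaMap_ι, reassoc_of% omegaMap_ι f]

instance (F : C ⥤ D) [F.Additive] : (leftSatelliteFunctor F).Additive where
  map_add {X Y f g} := by
    change leftSatelliteMap F (f + g) = leftSatelliteMap F f + leftSatelliteMap F g
    rw [← cancel_mono (kernel.ι _), Preadditive.add_comp,
      leftSatelliteMap_ι F f _ _ (overMap_π f) (omegaMap_ι f),
      leftSatelliteMap_ι F g _ _ (overMap_π g) (omegaMap_ι g),
      ← Preadditive.comp_add, ← F.map_add]
    refine leftSatelliteMap_ι F _ (overMap f + overMap g) _ ?_ ?_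
    · rw [Preadditive.add_comp, overMap_π, overMap_π, Preadditive.comp_add]
    · rw [Preadditive.add_comp, omegaMap_ι, omegaMap_ι, Preadditive.comp_add]

/-- The left satellite endofunctor `S₁`, on objects. -/
def leftSatellite (F : C ⥤+ D) : C ⥤+ D := AdditiveFunctor.of (leftSatelliteFunctor F.obj)

/-- The iterated left satellite `SₙF`, with `S₀F = F` and `Sₙ₊₁F = S₁(SₙF)`. -/
def leftSatelliteIter (F : C ⥤+ D) : ℕ → (C ⥤+ D)
  | 0 => F
  | n + 1 => leftSatellite (leftSatelliteIter F n)

end LeftSatellite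

/-! ### The right satellite `S¹F` -/

section RightSatellite

variable [EnoughInjectives C]

/-- `F(ΣX) ⟶ F(ΣY)`, followed by the projection onto the cokernel of `F(I) ⟶ F(ΣY)`, does not
depend on the choice of extension. -/
lemma map_cokernel_π_eq (F : C ⥤ D) [F.Additive] {X Y : C}
    (p p' : Injective.under X ⟶ Injective.under Y) (k k' : sigma X ⟶ sigma Y)
    (h : Injective.ι X ≫ p = Injective.ι X ≫ p')
    (hk : sigmaπ X ≫ k = p ≫ sigmaπ Y) (hk' : sigmaπ X ≫ k' = p' ≫ sigmaπ Y) :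
    F.map k ≫ cokernel.π (F.map (sigmaπ Y)) = F.map k' ≫ cokernel.π (F.map (sigmaπ Y)) := by
  have hs : Injective.ι X ≫ (p - p') = 0 := by rw [Preadditive.comp_sub, h, sub_self]
  have hkk : k - k' = cokernel.desc _ (p - p') hs ≫ sigmaπ Y := by
    rw [← cancel_epi (sigmaπ X), cokernel.π_desc_assoc, Preadditive.comp_sub, hk, hk',
      Preadditive.sub_comp]
  rw [← sub_eq_zero, ← Preadditive.sub_comp, ← F.map_sub, hkk, F.map_comp, Category.assoc,
    cokernel.condition, comp_zero]

/-- The morphism `S¹F(X) ⟶ S¹F(Y)` induced by `f : X ⟶ Y`. -/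
def rightSatelliteMap (F : C ⥤ D) [F.Additive] {X Y : C} (f : X ⟶ Y) :
    cokernel (F.map (sigmaπ X)) ⟶ cokernel (F.map (sigmaπ Y)) :=
  cokernel.map _ _ (F.map (underMap f)) (F.map (sigmaMap f))
    (by rw [← F.map_comp, ← F.map_comp, π_sigmaMap])

/-- The map on right satellites may be computed with any extension of `f`. -/
lemma π_rightSatelliteMap (F : C ⥤ D) [F.Additive] {X Y : C} (f : X ⟶ Y)
    (p : Injective.under X ⟶ Injective.under Y) (k : sigma X ⟶ sigma Y)
    (hp : Injective.ι X ≫ p = f ≫ Injective.ι Y) (hk : sigmaπ X ≫ k = p ≫ sigmaπ Y) :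
    cokernel.π (F.map (sigmaπ X)) ≫ rightSatelliteMap F f =
      F.map k ≫ cokernel.π (F.map (sigmaπ Y)) := by
  simp only [rightSatelliteMap, cokernel.map, cokernel.π_desc]
  exact map_cokernel_π_eq F _ p _ k (by rw [ι_underMap, hp]) (π_sigmaMap f) hk

/-- The right satellite of an additive functor, `S¹F(X) = coker (F(I) ⟶ F(ΣX))`. -/
def rightSatelliteFunctor (F : C ⥤ D) [F.Additive] : C ⥤ D where
  obj X := cokernel (F.map (sigmaπ X))
  map f := rightSatelliteMap F f
  map_id X := by
    rw [← cancel_epi (cokernel.π _), π_rightSatelliteMap F _ (𝟙 _) (𝟙 _) (by simp) (by simp)]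
    simp
  map_comp {X Y Z} f g := by
    rw [← cancel_epi (cokernel.π _),
      reassoc_of% π_rightSatelliteMap F f _ _ (ι_underMap f) (π_sigmaMap f),
      π_rightSatelliteMap F g _ _ (ι_underMap g) (π_sigmaMap g), ← Category.assoc, ← F.map_comp]
    refine π_rightSatelliteMap F _ (underMap f ≫ underMap g) _ ?_ ?_
    · rw [reassoc_of% ι_underMap f, ι_underMap, Category.assoc]
    · rw [reassoc_of% π_sigmaMap f, π_sigmaMap, Category.assoc]

instance (F : C ⥤ D) [F.Additive] : (rightSatelliteFunctor F).Additive where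
  map_add {X Y f g} := by
    change rightSatelliteMap F (f + g) = rightSatelliteMap F f + rightSatelliteMap F g
    rw [← cancel_epi (cokernel.π _), Preadditive.comp_add,
      π_rightSatelliteMap F f _ _ (ι_underMap f) (π_sigmaMap f),
      π_rightSatelliteMap F g _ _ (ι_underMap g) (π_sigmaMap g),
      ← Preadditive.add_comp, ← F.map_add]
    refine π_rightSatelliteMap F _ (underMap f + underMap g) _ ?_ ?_
    · rw [Preadditive.comp_add, ι_underMap, ι_underMap, Preadditive.add_comp]
    · rw [Preadditive.comp_add, π_sigmaMap, π_sigmaMap, Preadditive.add_comp]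

/-- The right satellite endofunctor `S¹`, on objects. -/
def rightSatellite (F : C ⥤+ D) : C ⥤+ D := AdditiveFunctor.of (rightSatelliteFunctor F.obj)

/-- The iterated right satellite `SⁿF`, with `S⁰F = F` and `Sⁿ⁺¹F = S¹(SⁿF)`. -/
def rightSatelliteIter (F : C ⥤+ D) : ℕ → (C ⥤+ D)
  | 0 => F
  | n + 1 => rightSatellite (rightSatelliteIter F n)

end RightSatellite

/-! ### Half exactness, stabilization, functors of `G`-dimension zero -/

/-- `F` is half exact: for every short exact sequence `0 ⟶ X ⟶ Y ⟶ Z ⟶ 0` the sequence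
`F(X) ⟶ F(Y) ⟶ F(Z)` is exact. -/
def IsHalfExact (F : C ⥤+ D) : Prop :=
  ∀ S : ShortComplex C, S.ShortExact → (S.map F.obj).Exact

/-- The projective stabilization of `F`: the cokernel of `L₀F ⟶ F`. -/
def projectiveStabilization [EnoughProjectives C] (F : C ⥤+ D) : C ⥤ D :=
  cokernel (F.obj.fromLeftDerivedZero)

/-- The canonical map from `F` to its projective stabilization. -/
def toProjectiveStabilization [EnoughProjectives C] (F : C ⥤+ D) :
    F.obj ⟶ projectiveStabilization F :=
  cokernel.π (F.obj.fromLeftDerivedZero)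

/-- `F` is projectively stable: it is its own projective stabilization, that is, the canonical
map from `F` to the projective stabilization is an isomorphism. -/
def IsProjectivelyStable [EnoughProjectives C] (F : C ⥤+ D) : Prop :=
  IsIso (toProjectiveStabilization F)

/-- The injective stabilization of `F`: the kernel of `F ⟶ R⁰F`. -/
def injectiveStabilization [EnoughInjectives C] (F : C ⥤+ D) : C ⥤ D :=
  kernel (F.obj.toRightDerivedZero)

/-- The canonical map from the injective stabilization of `F` to `F`. -/
def fromInjectiveStabilization [EnoughInjectives C] (F : C ⥤+ D) :
    injectiveStabilization F ⟶ F.obj :=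
  kernel.ι (F.obj.toRightDerivedZero)

/-- `F` is injectively stable: it is its own injective stabilization, that is, the canonical
map from the injective stabilization to `F` is an isomorphism. -/
def IsInjectivelyStable [EnoughInjectives C] (F : C ⥤+ D) : Prop :=
  IsIso (fromInjectiveStabilization F)

/-- A functor `F` has `G`-dimension zero if it is half exact and all its satellites `SⁿF` and
`SₙF`, `n ≥ 0` (so `F` itself is included), are both projectively and injectively stable. -/
structure HasGDimensionZero [EnoughProjectives C] [EnoughInjectives C] (F : C ⥤+ D) : Prop where
  isHalfExact : IsHalfExact F
  right_projectivelyStable : ∀ n : ℕ, IsProjectivelyStable (rightSatelliteIter F n)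
  right_injectivelyStable : ∀ n : ℕ, IsInjectivelyStable (rightSatelliteIter F n)
  left_projectivelyStable : ∀ n : ℕ, IsProjectivelyStable (leftSatelliteIter F n)
  left_injectivelyStable : ∀ n : ℕ, IsInjectivelyStable (leftSatelliteIter F n)

/-! ### Hom modulo projectives, objects of `G`-dimension zero -/

/-- The subgroup `𝒫(X, Y)` of `Hom(X, Y)` of the morphisms that factor through a projective. -/
def factorsThroughProjective (X Y : C) : AddSubgroup (X ⟶ Y) where
  carrier := {f | ∃ (P : C) (_ : Projective P) (a : X ⟶ P) (b : P ⟶ Y), a ≫ b = f}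
  zero_mem' := ⟨0, inferInstance, 0, 0, by simp⟩
  add_mem' := by
    rintro _ _ ⟨P, hP, a, b, rfl⟩ ⟨Q, hQ, a', b', rfl⟩
    exact ⟨P ⊞ Q, inferInstance, biprod.lift a a', biprod.desc b b', by simp⟩
  neg_mem' := by
    rintro _ ⟨P, hP, a, b, rfl⟩
    exact ⟨P, hP, -a, b, by simp⟩

/-- The functor `Hom(X, -)` modulo `𝒫(X, -)`, i.e. the Hom functor of the stable category. -/
def stableHomFunctor (X : C) : C ⥤ AddCommGrpCat.{v₁} where
  obj Y := AddCommGrpCat.of ((X ⟶ Y) ⧸ factorsThroughProjective X Y)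
  map {Y Z} g := AddCommGrpCat.ofHom <|
    QuotientAddGroup.map (factorsThroughProjective X Y) (factorsThroughProjective X Z)
      (Preadditive.rightComp X g) (by
        rintro _ ⟨P, hP, a, b, rfl⟩
        exact ⟨P, hP, a, b ≫ g, by simp [Preadditive.rightComp]⟩)
  map_id Y := by
    ext f
    simp [Preadditive.rightComp]
  map_comp g h := by
    ext f
    simp [Preadditive.rightComp]

instance (X : C) : (stableHomFunctor X).Additive where
  map_add {Y Z g h} := by
    ext x
    obtain ⟨f, rfl⟩ := QuotientAddGroup.mk_surjective x
    change (QuotientAddGroup.mk (f ≫ (g + h)) : (X ⟶ Z) ⧸ factorsThroughProjective X Z) =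
      QuotientAddGroup.mk (f ≫ g) + QuotientAddGroup.mk (f ≫ h)
    rw [Preadditive.comp_add, QuotientAddGroup.mk_add]

/-- The additive functor `Hom(X, -)` modulo `𝒫(X, -)`. -/
def stableHom (X : C) : C ⥤+ AddCommGrpCat.{v₁} := AdditiveFunctor.of (stableHomFunctor X)

/-- An object `X` (for instance a module) has `G`-dimension zero if the functor
`Hom(X, -)` modulo projectives has `G`-dimension zero. -/
def ObjHasGDimensionZero [EnoughProjectives C] [EnoughInjectives C] (X : C) : Prop :=
  HasGDimensionZero (stableHom X)

/-! ### Coherent rings and totally finitely presented functors -/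

/-- The property of being a finitely presented module. -/
def finitelyPresented (A : Type u) [Ring A] : ObjectProperty (ModuleCat.{u} A) :=
  fun M => Module.FinitePresentation A M

/-- `R` is coherent: the categories of finitely presented right modules (modules over the opposite
ring) and of finitely presented left modules are abelian. -/
def IsCoherentRing (R : Type u) [Ring R] : Prop :=
  Nonempty (Abelian (finitelyPresented Rᵐᵒᵖ).FullSubcategory) ∧
    Nonempty (Abelian (finitelyPresented R).FullSubcategory)

/-- `F` is totally finitely presented: there are finitely presented modules `X`, `Y` and a sequence
of functors `(Y, -) ⟶ (X, -) ⟶ F ⟶ 0` that is exact (at every module). -/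
def IsTotallyFinitelyPresented {A : Type u} [Ring A]
    (F : ModuleCat.{u} A ⥤+ AddCommGrpCat.{u}) : Prop :=
  ∃ (X Y : ModuleCat.{u} A) (_ : finitelyPresented A X) (_ : finitelyPresented A Y)
    (α : preadditiveCoyoneda.obj (Opposite.op Y) ⟶ preadditiveCoyoneda.obj (Opposite.op X))
    (β : preadditiveCoyoneda.obj (Opposite.op X) ⟶ F.obj),
    ∀ M : ModuleCat.{u} A,
      Function.Exact (α.app M) (β.app M) ∧ Function.Surjective (β.app M)

end FunctorLinkage

end

noncomputable section

namespace FunctorLinkage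

variable {C : Type u₁} [Category.{v₁} C] [Abelian C]
variable {D : Type u₂} [Category.{v₂} D] [Abelian D]

/-! ### Stability as vanishing on projectives and injectives -/

/-! Write `Z` for a cokernel and `Hom̲(M, -)` for `Hom(M, -)` modulo projectives. Two ideas carry
the theorem.

Stability means vanishing on projectives, respectively injectives. The connecting maps of the long
exact `Ext` sequences give `S₁ Ext¹(M, -) ≅ Hom̲(M, -)` and `S¹ Hom̲(M, -) ≅ Ext¹(M, -)`. So if `F ≅
Ext¹(M, -)`, the satellites of `F` and of `Hom̲(M, -)` form the same two-sided sequence up to a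
shift, and one functor has `G`-dimension zero exactly when the other has
(`hasGDimensionZero_iff_of_iso_ext`).

It remains to write `F` as an `Ext¹(M, -)` (`exists_iso_ext_of_isPresentedBy`). Let `F` be the
cokernel of `Hom(f, -)`. Vanishing on injectives makes `f` a monomorphism; half exactness then makes
`F` a direct summand of `Ext¹(Z, -)` with `Z = coker f` (`exists_retract_ext`). The idempotent on
`Ext¹(Z, -)` comes from an endomorphism `e` of `Z` that is idempotent modulo projectives. An
Eilenberg swindle on a countable coproduct of copies of `Z` splits `e`
(`exists_splitting_of_idempotent`), and the resulting summand is `M`. The infinite coproduct is why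
`M` need not be finitely presented. -/

lemma isIso_cokernel_π_iff {A B : D} (f : A ⟶ B) : IsIso (cokernel.π f) ↔ f = 0 := by
  constructor
  · intro h
    rw [← cancel_mono (cokernel.π f), cokernel.condition, zero_comp]
  · rintro rfl
    infer_instance

lemma isIso_kernel_ι_iff {A B : D} (f : A ⟶ B) : IsIso (kernel.ι f) ↔ f = 0 := by
  constructor
  · intro h
    rw [← cancel_epi (kernel.ι f), kernel.condition, comp_zero]
  · rintro rfl
    infer_instance

/-- The map `L₀F ⟶ F` is an isomorphism at projectives, so it can vanish only if `F` does there.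
Conversely its component at `X` is determined on `F(P₀)`, which maps epimorphically onto the
opcycles, `P₀` being the degree-zero term of a projective resolution. -/
lemma isProjectivelyStable_iff [EnoughProjectives C] (F : C ⥤+ D) :
    IsProjectivelyStable F ↔ ∀ P : C, Projective P → IsZero (F.obj.obj P) := by
  refine (isIso_cokernel_π_iff F.obj.fromLeftDerivedZero).trans ?_
  constructor
  · intro h P _
    rw [IsZero.iff_id_eq_zero, ← cancel_epi (F.obj.fromLeftDerivedZero.app P), h]
    simp
  · intro h
    ext X
    rw [(projectiveResolution X).fromLeftDerivedZero_eq F.obj]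
    change _ = 0
    have : (projectiveResolution X).fromLeftDerivedZero' F.obj = 0 := by
      rw [← cancel_epi (HomologicalComplex.pOpcycles _ _),
        ProjectiveResolution.pOpcycles_comp_fromLeftDerivedZero', comp_zero]
      exact (h _ ((projectiveResolution X).projective 0)).eq_of_src _ _
    rw [this]
    exact (congrArg (_ ≫ ·) comp_zero).trans comp_zero

lemma isInjectivelyStable_iff [EnoughInjectives C] (F : C ⥤+ D) :
    IsInjectivelyStable F ↔ ∀ I : C, Injective I → IsZero (F.obj.obj I) := by
  refine (isIso_kernel_ι_iff F.obj.toRightDerivedZero).trans ?_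
  constructor
  · intro h I _
    rw [IsZero.iff_id_eq_zero, ← cancel_mono (F.obj.toRightDerivedZero.app I), h]
    simp
  · intro h
    ext X
    rw [(injectiveResolution X).toRightDerivedZero_eq F.obj]
    have : (injectiveResolution X).toRightDerivedZero' F.obj = 0 := by
      rw [← cancel_mono (HomologicalComplex.iCycles _ _),
        InjectiveResolution.toRightDerivedZero'_comp_iCycles, zero_comp]
      exact (h _ ((injectiveResolution X).injective 0)).eq_of_tgt _ _
    rw [this]
    simp

/-- The functor `F` vanishes on projective and on injective objects. -/
def IsStable (F : C ⥤ D) : Prop :=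
  (∀ P : C, Projective P → IsZero (F.obj P)) ∧ (∀ I : C, Injective I → IsZero (F.obj I))

lemma IsStable.of_iso {F G : C ⥤ D} (hF : IsStable F) (e : Nonempty (F ≅ G)) : IsStable G := by
  obtain ⟨e⟩ := e
  exact ⟨fun P hP => (hF.1 P hP).of_iso (e.symm.app P),
    fun I hI => (hF.2 I hI).of_iso (e.symm.app I)⟩

lemma hasGDimensionZero_iff [EnoughProjectives C] [EnoughInjectives C] (F : C ⥤+ D) :
    HasGDimensionZero F ↔ IsHalfExact F ∧ (∀ n, IsStable (rightSatelliteIter F n).obj) ∧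
      ∀ n, IsStable (leftSatelliteIter F n).obj := by
  constructor
  · rintro ⟨h, h₁, h₂, h₃, h₄⟩
    exact ⟨h, fun n => ⟨(isProjectivelyStable_iff _).1 (h₁ n), (isInjectivelyStable_iff _).1 (h₂ n)⟩,
      fun n => ⟨(isProjectivelyStable_iff _).1 (h₃ n), (isInjectivelyStable_iff _).1 (h₄ n)⟩⟩
  · rintro ⟨h, h₁, h₂⟩
    exact ⟨h, fun n => (isProjectivelyStable_iff _).2 (h₁ n).1,
      fun n => (isInjectivelyStable_iff _).2 (h₁ n).2,
      fun n => (isProjectivelyStable_iff _).2 (h₂ n).1,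
      fun n => (isInjectivelyStable_iff _).2 (h₂ n).2⟩

/-! ### Satellites of isomorphic functors -/

/-- Isomorphic functors have isomorphic left satellites. -/
def leftSatelliteFunctorIso [EnoughProjectives C] {F G : C ⥤ D} [F.Additive] [G.Additive]
    (e : F ≅ G) : leftSatelliteFunctor F ≅ leftSatelliteFunctor G :=
  NatIso.ofComponents
    (fun X => kernel.mapIso (F.map (omegaι X)) (G.map (omegaι X)) (e.app _) (e.app _) (by simp))
    (fun {X Y} f => by
      change leftSatelliteMap F f ≫ kernel.map _ _ (e.hom.app _) (e.hom.app _) (by simp) =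
        kernel.map _ _ (e.hom.app _) (e.hom.app _) (by simp) ≫ leftSatelliteMap G f
      rw [← cancel_mono (kernel.ι (G.map (omegaι Y)))]
      simp [leftSatelliteMap])

/-- Isomorphic functors have isomorphic right satellites. -/
def rightSatelliteFunctorIso [EnoughInjectives C] {F G : C ⥤ D} [F.Additive] [G.Additive]
    (e : F ≅ G) : rightSatelliteFunctor F ≅ rightSatelliteFunctor G :=
  NatIso.ofComponents
    (fun X => cokernel.mapIso (F.map (sigmaπ X)) (G.map (sigmaπ X)) (e.app _) (e.app _) (by simp))
    (fun {X Y} f => by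
      change rightSatelliteMap F f ≫ cokernel.map _ _ (e.hom.app _) (e.hom.app _) (by simp) =
        cokernel.map _ _ (e.hom.app _) (e.hom.app _) (by simp) ≫ rightSatelliteMap G f
      rw [← cancel_epi (cokernel.π (F.map (sigmaπ X)))]
      simp [rightSatelliteMap])

lemma leftSatelliteIter_iso [EnoughProjectives C] {F G : C ⥤+ D} (e : F.obj ≅ G.obj) (n : ℕ) :
    Nonempty ((leftSatelliteIter F n).obj ≅ (leftSatelliteIter G n).obj) := by
  induction n with
  | zero => exact ⟨e⟩
  | succ n ih => exact ih.map fun e => leftSatelliteFunctorIso e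

lemma rightSatelliteIter_iso [EnoughInjectives C] {F G : C ⥤+ D} (e : F.obj ≅ G.obj) (n : ℕ) :
    Nonempty ((rightSatelliteIter F n).obj ≅ (rightSatelliteIter G n).obj) := by
  induction n with
  | zero => exact ⟨e⟩
  | succ n ih => exact ih.map fun e => rightSatelliteFunctorIso e

/-- The recursion puts the new `leftSatellite` outermost, while the shift argument needs it
innermost. -/
lemma leftSatelliteIter_leftSatellite [EnoughProjectives C] (F : C ⥤+ D) (n : ℕ) :
    leftSatelliteIter (leftSatellite F) n = leftSatelliteIter F (n + 1) := by
  induction n with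
  | zero => rfl
  | succ n ih => exact congrArg leftSatellite ih

lemma rightSatelliteIter_rightSatellite [EnoughInjectives C] (F : C ⥤+ D) (n : ℕ) :
    rightSatelliteIter (rightSatellite F) n = rightSatelliteIter F (n + 1) := by
  induction n with
  | zero => rfl
  | succ n ih => exact congrArg rightSatellite ih

/-- If `S¹H ≅ F` and `S₁F ≅ H`, then `F` and `H` have the same satellites up to a shift. -/
lemma hasGDimensionZero_iff_of_satellites [EnoughProjectives C] [EnoughInjectives C]
    {F H : C ⥤+ D} (hF : IsHalfExact F) (hH : IsHalfExact H)
    (e : (rightSatellite H).obj ≅ F.obj) (e' : (leftSatellite F).obj ≅ H.obj) :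
    HasGDimensionZero F ↔ HasGDimensionZero H := by
  have hl (n : ℕ) := leftSatelliteIter_iso e' n
  have hr (n : ℕ) := rightSatelliteIter_iso e n
  simp only [leftSatelliteIter_leftSatellite, rightSatelliteIter_rightSatellite] at hl hr
  rw [hasGDimensionZero_iff, hasGDimensionZero_iff]
  constructor
  · rintro ⟨-, h₁, h₂⟩
    refine ⟨hH, fun n => ?_, fun n => (h₂ (n + 1)).of_iso (hl n)⟩
    cases n with
    -- Here the two halves of the sequence meet: `S⁰H = H` is a left satellite of `F`, namely `S₁F`.
    | zero => exact (h₂ 1).of_iso (hl 0)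
    | succ n => exact (h₁ n).of_iso ((hr n).map Iso.symm)
  · rintro ⟨-, h₁, h₂⟩
    refine ⟨hF, fun n => (h₁ (n + 1)).of_iso (hr n), fun n => ?_⟩
    cases n with
    | zero => exact (h₁ 1).of_iso (hr 0)
    | succ n => exact (h₂ n).of_iso ((hl n).map Iso.symm)

end FunctorLinkage

end

noncomputable section

namespace FunctorLinkage

open Abelian

variable {C : Type u₁} [Category.{v₁} C] [Abelian C]

/-! ### Satellites of `Ext¹(M, -)` and of `Hom(M, -)` modulo projectives -/

/-- `Hom(M, -)` modulo projectives is half exact. -/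
lemma isHalfExact_stableHom [EnoughProjectives C] (M : C) : IsHalfExact (stableHom M) := by
  intro S hS
  have := hS.mono_f
  have := hS.epi_g
  rw [ShortComplex.ab_exact_iff]
  intro x hx
  obtain ⟨f, rfl⟩ := QuotientAddGroup.mk_surjective x
  obtain ⟨P, _, a, b, hab⟩ := (QuotientAddGroup.eq_zero_iff (f ≫ S.g)).1 hx
  -- Lifting `b` along the epimorphism `S.g` corrects `f` within its class to a map that `S.g` kills
  -- exactly.
  have hk : (f - a ≫ Projective.factorThru b S.g) ≫ S.g = 0 := by
    simp [hab]
  refine ⟨QuotientAddGroup.mk (hS.exact.lift _ hk), ?_⟩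
  change QuotientAddGroup.mk (hS.exact.lift _ hk ≫ S.f) = _
  rw [hS.exact.lift_f, QuotientAddGroup.eq]
  exact ⟨P, inferInstance, a, Projective.factorThru b S.g, by simp⟩

section Ext

variable [HasExt.{v₁} C]

/-- Morphisms which differ by a map factoring through a projective agree on `Extⁿ⁺¹`. -/
lemma mk₀_comp_eq_of_sub_mem {X Y Z : C} {n : ℕ} {f g : X ⟶ Y}
    (h : f - g ∈ factorsThroughProjective X Y) (y : Ext Y Z (n + 1)) :
    (Ext.mk₀ f).comp y (zero_add _) = (Ext.mk₀ g).comp y (zero_add _) := by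
  obtain ⟨P, _, a, b, hab⟩ := h
  have hf : f = g + a ≫ b := by rw [hab]; abel
  rw [hf, Ext.mk₀_add, Ext.add_comp, ← Ext.mk₀_comp_mk₀_assoc,
    Ext.eq_zero_of_projective ((Ext.mk₀ b).comp y _), Ext.comp_zero, add_zero]

/-- The connecting map `Hom(M, Z) ⟶ Ext¹(M, X)` of a short exact sequence `0 ⟶ X ⟶ Y ⟶ Z ⟶ 0`,
on `Hom` modulo projectives. -/
def stableHomToExt (M : C) {S : ShortComplex C} (hS : S.ShortExact) :
    (stableHomFunctor M).obj S.X₃ ⟶ (extFunctorObj.{v₁} M 1).obj S.X₁ :=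
  AddCommGrpCat.ofHom <| QuotientAddGroup.lift _
    (AddMonoidHom.mk' (fun f => (Ext.mk₀ f).comp hS.extClass (zero_add 1))
      (fun f g => by rw [Ext.mk₀_add, Ext.add_comp])) (by
      intro f hf
      have := mk₀_comp_eq_of_sub_mem (g := 0) (by simpa using hf) hS.extClass
      simpa using this)

lemma exists_comp_eq_of_comp_extClass_eq_zero (M : C) {S : ShortComplex C} (hS : S.ShortExact)
    (f : M ⟶ S.X₃) (h : (Ext.mk₀ f).comp hS.extClass (zero_add 1) = 0) : ∃ k, k ≫ S.g = f := by
  obtain ⟨y, hy⟩ := Ext.covariant_sequence_exact₃ M hS _ _ h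
  obtain ⟨k, rfl⟩ := (Ext.mk₀_bijective _ _).2 y
  rw [Ext.mk₀_comp_mk₀] at hy
  exact ⟨k, (Ext.mk₀_bijective _ _).1 hy⟩

lemma exists_mk₀_comp_extClass_eq (M : C) {S : ShortComplex C} (hS : S.ShortExact)
    (y : Ext M S.X₁ 1) (h : y.comp (Ext.mk₀ S.f) (add_zero 1) = 0) :
    ∃ f : M ⟶ S.X₃, (Ext.mk₀ f).comp hS.extClass (zero_add 1) = y := by
  obtain ⟨z, hz⟩ := Ext.covariant_sequence_exact₁ M hS _ h (zero_add 1)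
  obtain ⟨f, rfl⟩ := (Ext.mk₀_bijective _ _).2 z
  exact ⟨f, hz⟩

lemma stableHomToExt_naturality (M : C) {S T : ShortComplex C} (hS : S.ShortExact)
    (hT : T.ShortExact) (φ : S ⟶ T) :
    (stableHomFunctor M).map φ.τ₃ ≫ stableHomToExt M hT =
      stableHomToExt M hS ≫ (extFunctorObj.{v₁} M 1).map φ.τ₁ := by
  ext x
  obtain ⟨f, rfl⟩ := QuotientAddGroup.mk_surjective x
  change (Ext.mk₀ (f ≫ φ.τ₃)).comp hT.extClass (zero_add 1) =
    ((Ext.mk₀ f).comp hS.extClass (zero_add 1)).comp (Ext.mk₀ φ.τ₁) (add_zero 1)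
  rw [Ext.comp_assoc_of_third_deg_zero, ShortComplex.ShortExact.extClass_naturality hS hT φ,
    Ext.mk₀_comp_mk₀_assoc]

lemma stableHomToExt_comp_map (M : C) {S : ShortComplex C} (hS : S.ShortExact) :
    stableHomToExt M hS ≫ (extFunctorObj.{v₁} M 1).map S.f = 0 := by
  ext x
  obtain ⟨f, rfl⟩ := QuotientAddGroup.mk_surjective x
  change ((Ext.mk₀ f).comp hS.extClass (zero_add 1)).comp (Ext.mk₀ S.f) (add_zero 1) = 0
  rw [Ext.comp_assoc_of_third_deg_zero, hS.extClass_comp, Ext.comp_zero]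

lemma map_comp_stableHomToExt (M : C) {S : ShortComplex C} (hS : S.ShortExact) :
    (stableHomFunctor M).map S.g ≫ stableHomToExt M hS = 0 := by
  ext x
  obtain ⟨f, rfl⟩ := QuotientAddGroup.mk_surjective x
  change (Ext.mk₀ (f ≫ S.g)).comp hS.extClass (zero_add 1) = 0
  rw [← Ext.mk₀_comp_mk₀_assoc, hS.comp_extClass, Ext.comp_zero]

/-! ### The left satellite of `Ext¹(M, -)` -/

section LeftSatellite

variable [EnoughProjectives C]

/-- The chosen syzygy sequence `0 ⟶ ΩX ⟶ P ⟶ X ⟶ 0`. -/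
abbrev syzygySequence (X : C) : ShortComplex C :=
  ShortComplex.mk (omegaι X) (Projective.π X) (kernel.condition _)

lemma syzygySequence_shortExact (X : C) : (syzygySequence X).ShortExact where
  exact := ShortComplex.exact_kernel _
  mono_f := by dsimp; infer_instance
  epi_g := by dsimp; infer_instance

/-- The morphism of syzygy sequences induced by the chosen lift. -/
def syzygySequenceMap {X Y : C} (f : X ⟶ Y) : syzygySequence X ⟶ syzygySequence Y where
  τ₁ := omegaMap f
  τ₂ := overMap f
  τ₃ := f
  comm₁₂ := omegaMap_ι f
  comm₂₃ := overMap_π f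

/-- `Hom(M, X)` modulo projectives maps to the kernel of `Ext¹(M, ΩX) ⟶ Ext¹(M, P)`. -/
def stableHomToLeftSatelliteExt (M X : C) :
    (stableHomFunctor M).obj X ⟶ kernel ((extFunctorObj.{v₁} M 1).map (omegaι X)) :=
  kernel.lift _ (stableHomToExt M (syzygySequence_shortExact X))
    (stableHomToExt_comp_map M (syzygySequence_shortExact X))

/-- By the long exact sequence, the connecting map kills only maps that lift to `P`, hence factor
through a projective, and its image is the kernel of `Ext¹(M, ΩX) ⟶ Ext¹(M, P)`. -/
instance (M X : C) : IsIso (stableHomToLeftSatelliteExt M X) := by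
  have hm : Mono (stableHomToExt M (syzygySequence_shortExact X)) := by
    rw [AddCommGrpCat.mono_iff_injective, injective_iff_map_eq_zero]
    intro x hx
    obtain ⟨f, rfl⟩ := QuotientAddGroup.mk_surjective x
    obtain ⟨k, rfl⟩ := exists_comp_eq_of_comp_extClass_eq_zero M (syzygySequence_shortExact X) f hx
    exact (QuotientAddGroup.eq_zero_iff _).2
      ⟨_, Projective.projective_over X, k, Projective.π X, rfl⟩
  have : Mono (stableHomToLeftSatelliteExt M X) := by
    exact mono_of_mono_fac (kernel.lift_ι _ _ (stableHomToExt_comp_map M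
      (syzygySequence_shortExact X)))
  have : Epi (stableHomToLeftSatelliteExt M X) := by
    refine (ShortComplex.exact_iff_epi_kernel_lift (ShortComplex.mk _ _
      (stableHomToExt_comp_map M (syzygySequence_shortExact X)))).1 ?_
    rw [ShortComplex.ab_exact_iff]
    intro y hy
    obtain ⟨f, hf⟩ := exists_mk₀_comp_extClass_eq M (syzygySequence_shortExact X) y hy
    exact ⟨QuotientAddGroup.mk f, hf⟩
  exact isIso_of_mono_of_epi _

/-- `Hom(M, X)` modulo projectives is the kernel of `Ext¹(M, ΩX) ⟶ Ext¹(M, P)`. -/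
def stableHomLeftSatelliteExtIso (M X : C) :
    (stableHomFunctor M).obj X ≅ kernel ((extFunctorObj.{v₁} M 1).map (omegaι X)) :=
  asIso (stableHomToLeftSatelliteExt M X)

/-- The left satellite of `Ext¹(M, -)` is `Hom(M, -)` modulo projectives. -/
def leftSatelliteExtIso (M : C) :
    leftSatelliteFunctor (extFunctorObj.{v₁} M 1) ≅ stableHomFunctor M :=
  (NatIso.ofComponents (fun X => stableHomLeftSatelliteExtIso M X) (fun {X Y} f => by
    change (stableHomFunctor M).map f ≫ stableHomToLeftSatelliteExt M Y =
      stableHomToLeftSatelliteExt M X ≫ leftSatelliteMap _ f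
    rw [← cancel_mono (kernel.ι _), Category.assoc, Category.assoc,
      leftSatelliteMap_ι _ f _ _ (overMap_π f) (omegaMap_ι f)]
    simp only [stableHomToLeftSatelliteExt, kernel.lift_ι, kernel.lift_ι_assoc]
    exact stableHomToExt_naturality M (syzygySequence_shortExact X) (syzygySequence_shortExact Y)
      (syzygySequenceMap f))).symm

end LeftSatellite

/-! ### The right satellite of `Hom(M, -)` modulo projectives -/

section RightSatellite

variable [EnoughInjectives C]

/-- The chosen cosyzygy sequence `0 ⟶ X ⟶ I ⟶ ΣX ⟶ 0`. -/
abbrev cosyzygySequence (X : C) : ShortComplex C :=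
  ShortComplex.mk (Injective.ι X) (sigmaπ X) (cokernel.condition _)

lemma cosyzygySequence_shortExact (X : C) : (cosyzygySequence X).ShortExact where
  exact := ShortComplex.exact_cokernel _
  mono_f := by dsimp; infer_instance
  epi_g := by dsimp; infer_instance

/-- The morphism of cosyzygy sequences induced by the chosen extension. -/
def cosyzygySequenceMap {X Y : C} (f : X ⟶ Y) : cosyzygySequence X ⟶ cosyzygySequence Y where
  τ₁ := f
  τ₂ := underMap f
  τ₃ := sigmaMap f
  comm₁₂ := (ι_underMap f).symm
  comm₂₃ := (π_sigmaMap f).symm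

/-- The cokernel of `Hom(M, I) ⟶ Hom(M, ΣX)` (modulo projectives) maps to `Ext¹(M, X)`. -/
def rightSatelliteStableHomToExt (M X : C) :
    cokernel ((stableHomFunctor M).map (sigmaπ X)) ⟶ (extFunctorObj.{v₁} M 1).obj X :=
  cokernel.desc _ (stableHomToExt M (cosyzygySequence_shortExact X))
    (map_comp_stableHomToExt M (cosyzygySequence_shortExact X))

/-- The connecting map is onto because `Ext¹(M, I) = 0`, and it kills only the maps that lift to
`I`. -/
instance (M X : C) : IsIso (rightSatelliteStableHomToExt M X) := by
  have he : Epi (stableHomToExt M (cosyzygySequence_shortExact X)) := by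
    rw [AddCommGrpCat.epi_iff_surjective]
    intro y
    obtain ⟨f, hf⟩ := exists_mk₀_comp_extClass_eq M (cosyzygySequence_shortExact X) y
      (Ext.eq_zero_of_injective (I := Injective.under X) _)
    exact ⟨QuotientAddGroup.mk f, hf⟩
  have : Epi (rightSatelliteStableHomToExt M X) := by
    exact epi_of_epi_fac (cokernel.π_desc _ _ (map_comp_stableHomToExt M
      (cosyzygySequence_shortExact X)))
  have : Mono (rightSatelliteStableHomToExt M X) := by
    refine (ShortComplex.exact_iff_mono_cokernel_desc (ShortComplex.mk _ _
      (map_comp_stableHomToExt M (cosyzygySequence_shortExact X)))).1 ?_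
    rw [ShortComplex.ab_exact_iff]
    intro x hx
    obtain ⟨f, rfl⟩ := QuotientAddGroup.mk_surjective x
    obtain ⟨k, rfl⟩ :=
      exists_comp_eq_of_comp_extClass_eq_zero M (cosyzygySequence_shortExact X) f hx
    exact ⟨QuotientAddGroup.mk k, rfl⟩
  exact isIso_of_mono_of_epi _

/-- The cokernel of `Hom(M, I) ⟶ Hom(M, ΣX)` (modulo projectives) is `Ext¹(M, X)`. -/
def rightSatelliteStableHomExtIso (M X : C) :
    cokernel ((stableHomFunctor M).map (sigmaπ X)) ≅ (extFunctorObj.{v₁} M 1).obj X :=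
  asIso (rightSatelliteStableHomToExt M X)

/-- The right satellite of `Hom(M, -)` modulo projectives is `Ext¹(M, -)`. -/
def rightSatelliteStableHomIso (M : C) :
    rightSatelliteFunctor (stableHomFunctor M) ≅ extFunctorObj.{v₁} M 1 :=
  NatIso.ofComponents (fun X => rightSatelliteStableHomExtIso M X) (fun {X Y} f => by
    change rightSatelliteMap _ f ≫ rightSatelliteStableHomToExt M Y =
      rightSatelliteStableHomToExt M X ≫ (extFunctorObj.{v₁} M 1).map f
    rw [← cancel_epi (cokernel.π _),
      reassoc_of% π_rightSatelliteMap _ f _ _ (ι_underMap f) (π_sigmaMap f)]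
    simp only [rightSatelliteStableHomToExt, cokernel.π_desc, cokernel.π_desc_assoc]
    exact stableHomToExt_naturality M (cosyzygySequence_shortExact X)
      (cosyzygySequence_shortExact Y) (cosyzygySequenceMap f))

end RightSatellite

/-- If `F ≅ Ext¹(M, -)`, then `F` has `G`-dimension zero if and only if `M` has. -/
lemma hasGDimensionZero_iff_of_iso_ext [EnoughProjectives C] [EnoughInjectives C]
    {F : C ⥤+ AddCommGrpCat.{v₁}} (hF : IsHalfExact F) {M : C}
    (e : F.obj ≅ extFunctorObj.{v₁} M 1) : HasGDimensionZero F ↔ ObjHasGDimensionZero M :=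
  hasGDimensionZero_iff_of_satellites hF (isHalfExact_stableHom M)
    (rightSatelliteStableHomIso M ≪≫ e.symm)
    (leftSatelliteFunctorIso e ≪≫ leftSatelliteExtIso M)

end Ext

end FunctorLinkage

end

namespace FunctorLinkage

variable {C : Type u₁} [Category.{v₁} C] [Abelian C]

/-! ### Splitting idempotents modulo projectives -/

lemma comp_mem_factorsThroughProjective_left {X Y Z : C} (f : X ⟶ Y) {g : Y ⟶ Z}
    (hg : g ∈ factorsThroughProjective Y Z) : f ≫ g ∈ factorsThroughProjective X Z := by
  obtain ⟨P, hP, a, b, rfl⟩ := hg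
  exact ⟨P, hP, f ≫ a, b, by simp⟩

lemma comp_mem_factorsThroughProjective_right {X Y Z : C} {f : X ⟶ Y} (g : Y ⟶ Z)
    (hf : f ∈ factorsThroughProjective X Y) : f ≫ g ∈ factorsThroughProjective X Z := by
  obtain ⟨P, hP, a, b, rfl⟩ := hf
  exact ⟨P, hP, a, b ≫ g, by simp⟩

/-- If `φ` has a section `s` modulo projectives, then the idempotent `1 - φ ≫ s` splits modulo
projectives. -/
lemma exists_splitting_of_section {V W : C} (φ : V ⟶ W) (s : W ⟶ V)
    (h : s ≫ φ - 𝟙 W ∈ factorsThroughProjective W W) :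
    ∃ (M : C) (j : M ⟶ V) (q : V ⟶ M), q ≫ j = 𝟙 V - φ ≫ s ∧
      j ≫ q - 𝟙 M ∈ factorsThroughProjective M M := by
  obtain ⟨P, hP, a, b, hab⟩ := h
  -- Adding the projective `P` absorbs the error `s ≫ φ - 𝟙 W = a ≫ b`: `φ'` has an honest section,
  -- so its kernel is a direct summand of `V ⊞ P`, and that agrees with `V` modulo projectives.
  let φ' : V ⊞ P ⟶ W := biprod.desc φ b
  let s' : W ⟶ V ⊞ P := biprod.lift s (-a)
  have hs : s' ≫ φ' = 𝟙 W := by simp [φ', s', hab]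
  let q' : V ⊞ P ⟶ kernel φ' := kernel.lift φ' (𝟙 _ - φ' ≫ s') (by simp [hs])
  have hq : q' ≫ kernel.ι φ' = 𝟙 _ - φ' ≫ s' := kernel.lift_ι _ _ _
  have hj : kernel.ι φ' ≫ q' = 𝟙 _ := by
    rw [← cancel_mono (kernel.ι φ'), Category.assoc, hq]
    simp
  refine ⟨kernel φ', kernel.ι φ' ≫ biprod.fst, biprod.inl ≫ q', ?_, P, hP,
    kernel.ι φ' ≫ biprod.snd, -(biprod.inr ≫ q'), ?_⟩
  · rw [Category.assoc, reassoc_of% hq]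
    simp [φ', s', Preadditive.sub_comp]
  · have h1 : kernel.ι φ' ≫ (biprod.fst ≫ biprod.inl + biprod.snd ≫ biprod.inr) ≫ q' = 𝟙 _ := by
      rw [biprod.total, Category.id_comp, hj]
    rw [Preadditive.add_comp, Preadditive.comp_add] at h1
    rw [← h1]
    simp

/-! ### The Eilenberg swindle -/

section Swindle

variable {A : Type*} [Ring A] (e t u p : A)

/-- The algebra behind the splitting: `t` and `u` are shifts with `t * u = 1`. -/
lemma swindle_section (ht : e * t = t * e) (hu : e * u = u * e) (htu : t * u = 1) :
    ((1 - e) + e * t) * ((1 - e) + u * e) - 1 = (e * e - e) * (2 - t - u) := by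
  have h1 : e * t * (u * e) = e * e := by
    rw [mul_assoc, ← mul_assoc t, htu, one_mul]
  have h2 : (1 - e) * (u * e) = (e - e * e) * u := by
    rw [← hu]; noncomm_ring
  have h3 : e * t * (1 - e) = (e - e * e) * t := by
    rw [mul_sub, mul_one, mul_assoc, ← ht]; noncomm_ring
  rw [add_mul, mul_add, mul_add, h1, h2, h3]
  noncomm_ring

/-- If `e` were idempotent, the product would be `(1 - e) + e * (1 - p) = 1 - e * p`. The exact
error keeps `e * e - e` as a left factor, so that it lies in the ideal of maps through projectives.
-/
lemma swindle_retraction (hu : e * u = u * e) (hut : u * t = 1 - p) :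
    e * p - (1 - ((1 - e) + u * e) * ((1 - e) + e * t)) =
      (e * e - e) * (2 - t - u - p) := by
  have h1 : u * e * (e * t) = e * e * (1 - p) := by
    rw [← hut, ← hu, mul_assoc e u, ← mul_assoc u, ← hu, mul_assoc e u, ← mul_assoc]
  have h2 : u * e * (1 - e) = (e - e * e) * u := by
    rw [← hu, mul_sub, mul_one, mul_assoc, ← hu]; noncomm_ring
  rw [add_mul, mul_add, mul_add, h1, h2]
  noncomm_ring

end Swindle

lemma projective_sigma {ι : Type*} (P : ι → C) [HasCoproduct P] [∀ i, Projective (P i)] :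
    Projective (∐ P) where
  factors f e _ :=
    ⟨Limits.Sigma.desc fun i => Projective.factorThru (Limits.Sigma.ι P i ≫ f) e,
      Limits.Sigma.hom_ext _ _ fun i => by simp⟩

/-- In an abelian category with countable coproducts, idempotents modulo projectives split modulo
projectives. -/
lemma exists_splitting_of_idempotent [HasCoproductsOfShape ℕ C] {Z : C} (e : Z ⟶ Z)
    (he : e ≫ e - e ∈ factorsThroughProjective Z Z) :
    ∃ (M : C) (m : M ⟶ Z) (n : Z ⟶ M), n ≫ m - e ∈ factorsThroughProjective Z Z ∧
      m ≫ e ≫ n - 𝟙 M ∈ factorsThroughProjective M M := by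
  obtain ⟨P, hP, a, b, hab⟩ := he
  -- On `W`, `E` is `e` on each copy, `U` shifts up, `T` shifts down and kills copy `0`, and `p`
  -- projects onto copy `0`. In `End W` a product `f * g` means `g ≫ f`.
  let W : C := ∐ fun _ : ℕ => Z
  let ι (i : ℕ) : Z ⟶ W := Sigma.ι (fun _ : ℕ => Z) i
  let E₀ : W ⟶ W := Limits.Sigma.map fun _ => e
  let E : End W := E₀
  let T : End W := Sigma.desc fun i => Nat.casesOn i 0 ι
  let U : End W := Sigma.desc fun i => ι (i + 1)
  let π₀ : W ⟶ Z := Sigma.desc fun i => Nat.casesOn i (𝟙 Z) fun _ => 0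
  let p : End W := π₀ ≫ ι 0
  have hιE (i : ℕ) : ι i ≫ E₀ = e ≫ ι i := by simp [ι, E₀]
  have hιT0 : ι 0 ≫ T = 0 := by simp [ι, T]
  have hιT (i : ℕ) : ι (i + 1) ≫ T = ι i := by simp [ι, T]
  have hιU (i : ℕ) : ι i ≫ U = ι (i + 1) := by simp [ι, U]
  have hιπ0 : ι 0 ≫ π₀ = 𝟙 Z := by simp [ι, π₀]
  have hιπ (i : ℕ) : ι (i + 1) ≫ π₀ = 0 := by simp [ι, π₀]
  have hW {X : C} {f g : W ⟶ X} (h : ∀ i, ι i ≫ f = ι i ≫ g) : f = g := Sigma.hom_ext _ _ h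
  have hET : E * T = T * E := by
    refine hW fun i => ?_
    change ι i ≫ T ≫ E₀ = ι i ≫ E₀ ≫ T
    cases i with
    | zero => rw [reassoc_of% hιT0, reassoc_of% hιE 0, hιT0]; simp
    | succ i => rw [reassoc_of% hιT i, reassoc_of% hιE (i + 1), hιT, hιE]
  have hEU : E * U = U * E := by
    refine hW fun i => ?_
    change ι i ≫ U ≫ E₀ = ι i ≫ E₀ ≫ U
    rw [reassoc_of% hιU i, reassoc_of% hιE i, hιU, hιE]
  have hTU : T * U = 1 := by
    refine hW fun i => ?_
    change ι i ≫ U ≫ T = ι i ≫ 𝟙 W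
    rw [reassoc_of% hιU i, hιT, Category.comp_id]
  have hUT : U * T = 1 - p := by
    refine hW fun i => ?_
    change ι i ≫ T ≫ U = ι i ≫ (𝟙 W - π₀ ≫ ι 0)
    rw [Preadditive.comp_sub, Category.comp_id]
    cases i with
    | zero => rw [reassoc_of% hιT0, reassoc_of% hιπ0]; simp
    | succ i => rw [reassoc_of% hιT i, hιU, reassoc_of% hιπ i]; simp
  have hEE (f : End W) : (E * E - E) * f ∈ factorsThroughProjective W W := by
    refine comp_mem_factorsThroughProjective_left f ?_
    -- The factorization of `e ≫ e - e` is repeated on each copy; a coproduct of projectives is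
    -- projective.
    refine ⟨∐ fun _ : ℕ => P, projective_sigma _, Limits.Sigma.map fun _ => a, Limits.Sigma.map fun _ => b, ?_⟩
    refine hW fun i => ?_
    change _ = ι i ≫ (E₀ ≫ E₀ - E₀)
    rw [Preadditive.comp_sub, reassoc_of% hιE i, hιE, ← Category.assoc e, ← Preadditive.sub_comp, ← hab]
    simp [ι]
  -- Modulo projectives, `φ` is the identity on the part `1 - E` and shifts the part `E` down. It is
  -- onto with section `s`, and what it loses is the part `E` of copy `0`, that is, `e` on `Z`.
  let φ : End W := (1 - E) + E * T
  let s : End W := (1 - E) + U * E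
  have hsφ : φ * s - 1 ∈ factorsThroughProjective W W := by
    rw [swindle_section E T U hET hEU hTU]
    exact hEE _
  have hφs : E * p - (1 - s * φ) ∈ factorsThroughProjective W W := by
    rw [swindle_retraction E T U p hEU hUT]
    exact hEE _
  obtain ⟨M, j, q, hqj, hjq⟩ := exists_splitting_of_section φ s hsφ
  have hEp : π₀ ≫ e ≫ ι 0 = (π₀ ≫ ι 0) ≫ E₀ := by
    rw [Category.assoc, hιE]
  have hp : π₀ ≫ e ≫ ι 0 - q ≫ j ∈ factorsThroughProjective W W := by
    rw [hqj, hEp]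
    exact hφs
  -- `M` splits `E * p` modulo projectives; since `E * p` lives on copy `0`, restricting there
  -- splits `e`.
  refine ⟨M, j ≫ π₀, ι 0 ≫ q, ?_, ?_⟩
  · have := comp_mem_factorsThroughProjective_left (ι 0)
      (comp_mem_factorsThroughProjective_right π₀ (neg_mem hp))
    convert this using 1
    simp [Preadditive.comp_sub, Preadditive.sub_comp, reassoc_of% hιπ0, hιπ0]
  · have h1 := comp_mem_factorsThroughProjective_left j
      (comp_mem_factorsThroughProjective_right q hp)
    have h2 := comp_mem_factorsThroughProjective_right (j ≫ q) hjq
    convert add_mem (add_mem h1 h2) hjq using 1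
    simp [Preadditive.comp_sub, Preadditive.sub_comp]

end FunctorLinkage

namespace FunctorLinkage

open Abelian

variable {C : Type u₁} [Category.{v₁} C] [Abelian C]

/-! ### Functors presented by a morphism and an element -/

/-- The functor `F` is the cokernel of `Hom(f, -)`, with `x` the image of the identity. -/
structure IsPresentedBy (F : C ⥤ AddCommGrpCat.{v₁}) {X Y : C} (f : X ⟶ Y) (x : F.obj X) :
    Prop where
  exists_map_eq {M : C} (u : F.obj M) : ∃ h : X ⟶ M, F.map h x = u
  map_eq_zero_iff {M : C} (h : X ⟶ M) : F.map h x = 0 ↔ ∃ k, f ≫ k = h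

lemma map_sub_apply (F : C ⥤ AddCommGrpCat.{v₁}) [F.Additive] {X M : C} (h h' : X ⟶ M)
    (x : F.obj X) : F.map (h - h') x = F.map h x - F.map h' x := by
  rw [F.map_sub]
  rfl

lemma map_add_apply (F : C ⥤ AddCommGrpCat.{v₁}) [F.Additive] {X M : C} (h h' : X ⟶ M)
    (x : F.obj X) : F.map (h + h') x = F.map h x + F.map h' x := by
  rw [F.map_add]
  rfl

lemma map_comp_apply (F : C ⥤ AddCommGrpCat.{v₁}) {X Y Z : C} (h : X ⟶ Y) (h' : Y ⟶ Z)
    (x : F.obj X) : F.map (h ≫ h') x = F.map h' (F.map h x) := by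
  rw [F.map_comp]
  rfl

lemma natTrans_naturality_apply {F G : C ⥤ AddCommGrpCat.{v₁}} (τ : F ⟶ G) {X Y : C} (h : X ⟶ Y)
    (x : F.obj X) : τ.app Y (F.map h x) = G.map h (τ.app X x) :=
  ConcreteCategory.congr_hom (τ.naturality h) x

namespace IsPresentedBy

variable {F G : C ⥤ AddCommGrpCat.{v₁}} {X Y : C} {f : X ⟶ Y} {x : F.obj X}

lemma map_self (hx : IsPresentedBy F f x) : F.map f x = 0 :=
  (hx.map_eq_zero_iff f).2 ⟨𝟙 Y, by simp⟩

lemma natTrans_ext (hx : IsPresentedBy F f x) {σ τ : F ⟶ G} (h : σ.app X x = τ.app X x) :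
    σ = τ := by
  ext M u
  obtain ⟨k, rfl⟩ := hx.exists_map_eq u
  rw [natTrans_naturality_apply, natTrans_naturality_apply, h]

/-- Yoneda for a cokernel of representables: send `F.map h x` to `G.map h y`. Two choices of `h`
differ by a map through `f`, which `G` sends to one killing `y`. -/
lemma exists_natTrans [F.Additive] [G.Additive] (hx : IsPresentedBy F f x) (y : G.obj X)
    (hy : G.map f y = 0) : ∃ τ : F ⟶ G, τ.app X x = y := by
  have key {M : C} (h h' : X ⟶ M) (e : F.map h x = F.map h' x) : G.map h y = G.map h' y := by
    obtain ⟨k, hk⟩ := (hx.map_eq_zero_iff (h - h')).1 (by rw [map_sub_apply, e, sub_self])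
    rw [← sub_eq_zero, ← map_sub_apply, ← hk, map_comp_apply, hy, map_zero]
  choose r hr using fun (M : C) (u : F.obj M) => hx.exists_map_eq u
  refine ⟨{ app := fun M => AddCommGrpCat.ofHom (AddMonoidHom.mk' (fun u => G.map (r M u) y) ?_)
            naturality := ?_ }, ?_⟩
  · intro u v
    rw [← map_add_apply]
    exact key _ _ (by rw [map_add_apply, hr, hr, hr])
  · intro M N h
    ext u
    change G.map (r N (F.map h u)) y = G.map h (G.map (r M u) y)
    rw [← map_comp_apply]
    exact key _ _ (by rw [map_comp_apply, hr, hr])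
  · change G.map (r X x) y = y
    rw [key (r X x) (𝟙 X) (by rw [hr, F.map_id]; rfl), G.map_id]
    rfl

/-- An embedding of `X` into an injective `I` sends `x` into `F(I) = 0`, hence factors through `f`.
-/
lemma mono [EnoughInjectives C] (hx : IsPresentedBy F f x)
    (hF : ∀ I : C, Injective I → IsZero (F.obj I)) : Mono f := by
  have := AddCommGrpCat.subsingleton_of_isZero (hF (Injective.under X) inferInstance)
  obtain ⟨k, hk⟩ := (hx.map_eq_zero_iff (Injective.ι X)).1 (Subsingleton.elim _ _)
  exact mono_of_mono_fac hk

end IsPresentedBy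

/-! ### Half exact functors vanishing on injectives -/

/-- If `f : X ⟶ Y` is a monomorphism with cokernel `Z`, then `0 ⟶ ΩZ ⟶ P ⊞ X ⟶ Y ⟶ 0` is exact. -/
lemma exists_shortExact_omega [EnoughProjectives C] {X Y : C} (f : X ⟶ Y) [Mono f] :
    ∃ (g : omega (cokernel f) ⟶ X) (h : Projective.over (cokernel f) ⟶ Y)
      (_ : h ≫ cokernel.π f = Projective.π (cokernel f)) (w : omegaι (cokernel f) ≫ h = g ≫ f),
      (ShortComplex.mk (biprod.lift (omegaι (cokernel f)) g) (biprod.desc h (-f))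
        (by simp [w])).ShortExact := by
  let h : Projective.over (cokernel f) ⟶ Y :=
    Projective.factorThru (Projective.π _) (cokernel.π f)
  have hh : h ≫ cokernel.π f = Projective.π (cokernel f) := Projective.factorThru_comp _ _
  -- On `ΩZ` the lift `h` dies in `Z = coker f`, so it factors through `f`. The resulting square is
  -- a pullback and a pushout, and the sign in `-f` turns it into a complex.
  let g : omega (cokernel f) ⟶ X :=
    Abelian.monoLift f (omegaι (cokernel f) ≫ h) (by simp [hh])
  have w : omegaι (cokernel f) ≫ h = g ≫ f := (Abelian.monoLift_comp f _ _).symm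
  refine ⟨g, h, hh, w, ?_⟩
  have : Mono (biprod.lift (omegaι (cokernel f)) g) :=
    mono_of_mono_fac (biprod.lift_fst (omegaι (cokernel f)) g)
  have : Epi (biprod.desc h (-f)) := by
    refine Preadditive.epi_of_cancel_zero _ fun {A} k hk => ?_
    have h1 : h ≫ k = 0 := by simpa using biprod.inl ≫= hk
    have h2 : f ≫ k = 0 := by simpa using biprod.inr ≫= hk
    rw [← cokernel.π_desc f k h2] at h1 ⊢
    rw [← Category.assoc, hh] at h1
    rw [(cancel_epi (Projective.π (cokernel f))).1 (h1.trans comp_zero.symm), comp_zero]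
  have key {A : C} (k : A ⟶ Projective.over (cokernel f) ⊞ X) (hk : k ≫ biprod.desc h (-f) = 0) :
      ∃ l, l ≫ biprod.lift (omegaι (cokernel f)) g = k := by
    have e : (k ≫ biprod.fst) ≫ h = (k ≫ biprod.snd) ≫ f := by
      rw [biprod.desc_eq, Preadditive.comp_add, Preadditive.comp_neg, Preadditive.comp_neg,
        ← sub_eq_add_neg, sub_eq_zero] at hk
      simpa using hk
    have hk0 : (k ≫ biprod.fst) ≫ Projective.π (cokernel f) = 0 := by
      rw [← hh, ← Category.assoc, e]; simp
    have e1 : kernel.lift _ _ hk0 ≫ g = k ≫ biprod.snd := by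
      rw [← cancel_mono f, Category.assoc, ← w, ← e, kernel.lift_ι_assoc]
    exact ⟨kernel.lift _ _ hk0, biprod.hom_ext _ _ (by simp) (by simpa using e1)⟩
  exact ShortComplex.ShortExact.mk' (ShortComplex.exact_of_f_is_kernel _
    (KernelFork.IsLimit.ofι' _ _ fun k hk => ⟨(key k hk).choose, (key k hk).choose_spec⟩)) ‹_› ‹_›

/-! ### Direct summands of `Ext¹(Z, -)` -/

section Ext

variable [HasExt.{v₁} C] [EnoughProjectives C]

/-- The class in `Ext¹(Z, ΩZ)` of the chosen syzygy sequence. -/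
noncomputable def omegaClass (Z : C) : (extFunctorObj.{v₁} Z 1).obj (omega Z) :=
  (syzygySequence_shortExact Z).extClass

/-- `Ext¹(Z, -)` is the cokernel of `Hom(P, -) ⟶ Hom(ΩZ, -)`. -/
lemma isPresentedBy_ext (Z : C) : IsPresentedBy (extFunctorObj.{v₁} Z 1) (omegaι Z) (omegaClass Z) where
  exists_map_eq {M} u := by
    obtain ⟨y, hy⟩ := Ext.contravariant_sequence_exact₃ (syzygySequence_shortExact Z) M
      (u : Ext Z M 1) (Ext.eq_zero_of_projective (P := Projective.over Z) _) (add_zero 1)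
    obtain ⟨h, rfl⟩ := (Ext.mk₀_bijective _ _).2 y
    exact ⟨h, hy⟩
  map_eq_zero_iff {M} h := by
    change (syzygySequence_shortExact Z).extClass.comp (Ext.mk₀ h) (add_zero 1) = 0 ↔ _
    constructor
    · intro e
      obtain ⟨y, hy⟩ := Ext.contravariant_sequence_exact₁ (syzygySequence_shortExact Z) M _ _ e
      obtain ⟨k, rfl⟩ := (Ext.mk₀_bijective _ _).2 y
      rw [Ext.mk₀_comp_mk₀] at hy
      exact ⟨k, (Ext.mk₀_bijective _ _).1 hy⟩
    · rintro ⟨k, rfl⟩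
      rw [← Ext.mk₀_comp_mk₀, ← Ext.comp_assoc_of_third_deg_zero,
        (syzygySequence_shortExact Z).extClass_comp, Ext.zero_comp]

/-- A half exact functor which is the cokernel of `Hom(f, -)` for a monomorphism `f` is a direct
summand of `Ext¹(coker f, -)`. -/
lemma exists_retract_ext (F : C ⥤+ AddCommGrpCat.{v₁}) (hF : IsHalfExact F) {X Y : C} (f : X ⟶ Y)
    [Mono f] {x : F.obj.obj X} (hx : IsPresentedBy F.obj f x) :
    ∃ (i : F.obj ⟶ extFunctorObj.{v₁} (cokernel f) 1)
      (r : extFunctorObj.{v₁} (cokernel f) 1 ⟶ F.obj), i ≫ r = 𝟙 F.obj := by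
  obtain ⟨g, h, hh, w, hS⟩ := exists_shortExact_omega f
  have hT : (ShortComplex.mk f (cokernel.π f) (cokernel.condition f)).ShortExact :=
    { exact := ShortComplex.exact_cokernel _
      mono_f := ‹_›
      epi_g := by dsimp; infer_instance }
  obtain ⟨i, hi⟩ := hx.exists_natTrans (G := extFunctorObj.{v₁} (cokernel f) 1)
    (hT.extClass : Ext (cokernel f) X 1) hT.extClass_comp
  -- Since `F(f)` kills `x`, the element `(0, x)` of `F(P ⊞ X)` dies in `F(Y)`. Half exactness lifts
  -- it to `t` in `F(ΩZ)`, which dies in `F(P)` and maps to `x` under `g`; such a `t` defines `r`.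
  obtain ⟨t, ht⟩ : ∃ t : F.obj.obj (omega (cokernel f)),
      F.obj.map (biprod.lift (omegaι (cokernel f)) g) t = F.obj.map biprod.inr x := by
    refine (ShortComplex.ab_exact_iff _).1 (hF _ hS) (F.obj.map biprod.inr x) ?_
    change F.obj.map (biprod.desc h (-f)) (F.obj.map biprod.inr x) = 0
    rw [← map_comp_apply, biprod.inr_desc]
    exact (hx.map_eq_zero_iff _).2 ⟨-𝟙 Y, by simp⟩
  have ht1 : F.obj.map (omegaι (cokernel f)) t = 0 := by
    rw [← biprod.lift_fst (omegaι (cokernel f)) g, map_comp_apply, ht, ← map_comp_apply,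
      biprod.inr_fst]
    exact (hx.map_eq_zero_iff _).2 ⟨0, by simp⟩
  have ht2 : F.obj.map g t = x := by
    rw [← biprod.lift_snd (omegaι (cokernel f)) g, map_comp_apply, ht, ← map_comp_apply,
      biprod.inr_snd, F.obj.map_id]
    rfl
  obtain ⟨r, hr⟩ := (isPresentedBy_ext (cokernel f)).exists_natTrans t ht1
  refine ⟨i, r, hx.natTrans_ext ?_⟩
  change r.app X (i.app X x) = x
  -- The extension given by `f` is the pushout of the syzygy sequence along `g`, so `i ≫ r` sends
  -- `x` to `F(g)(t) = x`.
  have hg : (hT.extClass : Ext (cokernel f) X 1) =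
      (extFunctorObj.{v₁} (cokernel f) 1).map g (omegaClass (cokernel f)) := by
    have := ShortComplex.ShortExact.extClass_naturality
      (syzygySequence_shortExact (cokernel f)) hT
      { τ₁ := g, τ₂ := h, τ₃ := 𝟙 _, comm₁₂ := w.symm, comm₂₃ := by simp [hh] }
    dsimp at this
    rw [Ext.mk₀_id_comp] at this
    exact this.symm
  rw [hi, hg, natTrans_naturality_apply, hr, ht2]

/-- The natural transformation `Ext¹(Y, -) ⟶ Ext¹(X, -)` induced by `f : X ⟶ Y`. -/
noncomputable def extPrecomp {X Y : C} (f : X ⟶ Y) :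
    extFunctorObj.{v₁} Y 1 ⟶ extFunctorObj.{v₁} X 1 :=
  (extFunctor.{v₁} 1).map f.op

lemma extPrecomp_comp {X Y Z : C} (f : X ⟶ Y) (g : Y ⟶ Z) :
    extPrecomp (f ≫ g) = extPrecomp g ≫ extPrecomp f :=
  (extFunctor.{v₁} 1).map_comp g.op f.op

lemma extPrecomp_id (X : C) : extPrecomp (𝟙 X) = 𝟙 (extFunctorObj.{v₁} X 1) :=
  (extFunctor.{v₁} 1).map_id (Opposite.op X)

lemma extPrecomp_eq {X Y : C} {f g : X ⟶ Y} (h : f - g ∈ factorsThroughProjective X Y) :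
    extPrecomp f = extPrecomp g := by
  ext M y
  exact mk₀_comp_eq_of_sub_mem h (y : Ext Y M 1)

/-- Every natural endomorphism of `Ext¹(Z, -)` is induced by an endomorphism of `Z`. -/
lemma exists_extPrecomp_eq (Z : C) (τ : extFunctorObj.{v₁} Z 1 ⟶ extFunctorObj.{v₁} Z 1) :
    ∃ e : Z ⟶ Z, extPrecomp e = τ := by
  have hZ := isPresentedBy_ext Z
  -- `τ` is determined by its value on `omegaClass Z`. That value dies in `Ext¹(Z, P)`, hence comes
  -- from some `e` under the connecting map.
  obtain ⟨e, he⟩ := exists_mk₀_comp_extClass_eq Z (syzygySequence_shortExact Z)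
    (τ.app (omega Z) (omegaClass Z)) (by
      refine (natTrans_naturality_apply τ (omegaι Z) _).symm.trans ?_
      rw [hZ.map_self]
      exact map_zero _)
  exact ⟨e, hZ.natTrans_ext he⟩

/-- Testing on the universal class `omegaClass Z` suffices: a map that pulls it back to zero lifts
to the projective covering `Z`. -/
lemma sub_mem_factorsThroughProjective {X Z : C} {f g : X ⟶ Z}
    (h : extPrecomp f = extPrecomp g) : f - g ∈ factorsThroughProjective X Z := by
  have h1 := ConcreteCategory.congr_hom (congr_app h (omega Z))
    (omegaClass Z)
  change (Ext.mk₀ f).comp (syzygySequence_shortExact Z).extClass (zero_add 1) =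
    (Ext.mk₀ g).comp (syzygySequence_shortExact Z).extClass (zero_add 1) at h1
  obtain ⟨k, hk⟩ := exists_comp_eq_of_comp_extClass_eq_zero X (syzygySequence_shortExact Z)
    (f - g) (by rw [sub_eq_add_neg, Ext.mk₀_add, Ext.add_comp, Ext.mk₀_neg, Ext.neg_comp, h1,
      add_neg_cancel])
  exact ⟨_, Projective.projective_over Z, k, Projective.π Z, hk⟩

/-- A direct summand of `Ext¹(Z, -)` is isomorphic to `Ext¹(M, -)` for some object `M`. -/
lemma exists_iso_ext_of_retract [HasCoproductsOfShape ℕ C] {F : C ⥤ AddCommGrpCat.{v₁}} {Z : C}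
    (i : F ⟶ extFunctorObj.{v₁} Z 1) (r : extFunctorObj.{v₁} Z 1 ⟶ F) (hir : i ≫ r = 𝟙 F) :
    ∃ M : C, Nonempty (F ≅ extFunctorObj.{v₁} M 1) := by
  obtain ⟨e, he⟩ := exists_extPrecomp_eq Z (r ≫ i)
  -- `r ≫ i` is idempotent, and `extPrecomp` is faithful modulo projectives, so `e` is idempotent
  -- modulo projectives.
  obtain ⟨M, m, n, hnm, hmn⟩ := exists_splitting_of_idempotent e
    (sub_mem_factorsThroughProjective (by
      rw [extPrecomp_comp, he, Category.assoc, reassoc_of% hir]))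
  have h1 : extPrecomp m ≫ extPrecomp n = r ≫ i := by
    rw [← extPrecomp_comp, extPrecomp_eq hnm, he]
  have h2 : extPrecomp n ≫ r ≫ i ≫ extPrecomp m = 𝟙 _ := by
    have := extPrecomp_eq hmn
    rw [extPrecomp_comp, extPrecomp_comp, he, extPrecomp_id] at this
    simpa using this
  refine ⟨M, ⟨⟨i ≫ extPrecomp m, extPrecomp n ≫ r, ?_, ?_⟩⟩⟩
  · rw [Category.assoc, reassoc_of% h1, hir, Category.comp_id, hir]
  · rw [Category.assoc, h2]

/-- A half exact functor vanishing on injectives which is the cokernel of a map of representable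
functors is isomorphic to `Ext¹(M, -)` for some object `M`. -/
lemma exists_iso_ext_of_isPresentedBy [EnoughInjectives C] [HasCoproductsOfShape ℕ C]
    (F : C ⥤+ AddCommGrpCat.{v₁}) (hF : IsHalfExact F)
    (hI : ∀ I : C, Injective I → IsZero (F.obj.obj I)) {X Y : C} (f : X ⟶ Y) {x : F.obj.obj X}
    (hx : IsPresentedBy F.obj f x) : ∃ M : C, Nonempty (F.obj ≅ extFunctorObj.{v₁} M 1) := by
  have := hx.mono hI
  obtain ⟨i, r, hir⟩ := exists_retract_ext F hF f hx
  exact exists_iso_ext_of_retract i r hir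

end Ext

/-- A totally finitely presented functor is the cokernel of some `Hom(f, -)`. -/
lemma IsTotallyFinitelyPresented.exists_isPresentedBy {A : Type u} [Ring A]
    {F : ModuleCat.{u} A ⥤+ AddCommGrpCat.{u}} (hF : IsTotallyFinitelyPresented F) :
    ∃ (X Y : ModuleCat.{u} A) (f : X ⟶ Y) (x : F.obj.obj X), IsPresentedBy F.obj f x := by
  obtain ⟨X, Y, -, -, α, β, h⟩ := hF
  have hβ {M : ModuleCat.{u} A} (k : X ⟶ M) : F.obj.map k (β.app X (𝟙 X)) = β.app M k := by
    refine (natTrans_naturality_apply β k (𝟙 X)).symm.trans ?_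
    exact congrArg (β.app M) (Category.id_comp k)
  have hα {M : ModuleCat.{u} A} (k : Y ⟶ M) : α.app M k = (α.app Y (𝟙 Y) : X ⟶ Y) ≫ k := by
    refine Eq.trans ?_ (natTrans_naturality_apply α k (𝟙 Y))
    exact congrArg (α.app M) (Category.id_comp k).symm
  refine ⟨X, Y, α.app Y (𝟙 Y), β.app X (𝟙 X), ⟨fun {M} u => ?_, fun {M} k => ?_⟩⟩
  · obtain ⟨k, rfl⟩ := (h M).2 u
    exact ⟨k, hβ k⟩
  · rw [hβ]
    refine ((h M).1 k).trans ⟨?_, ?_⟩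
    · rintro ⟨l, hl⟩
      exact ⟨l, (hα l).symm.trans hl⟩
    · rintro ⟨l, hl⟩
      exact ⟨l, (hα l).trans hl⟩

end FunctorLinkage

theorem mainTheorem11 {R : Type u} [Ring R] (hR : FunctorLinkage.IsCoherentRing R)
    (F : ModuleCat.{u} Rᵐᵒᵖ ⥤+ AddCommGrpCat.{u})
    (hF : FunctorLinkage.IsTotallyFinitelyPresented F)
    (hF' : FunctorLinkage.IsHalfExact F) :
    FunctorLinkage.HasGDimensionZero F ↔
      ∃ M : ModuleCat.{u} Rᵐᵒᵖ, FunctorLinkage.ObjHasGDimensionZero M ∧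
        Nonempty (F.obj ≅ Abelian.extFunctorObj.{u} M 1) := by
  constructor
  · intro h
    obtain ⟨X, Y, f, x, hx⟩ := hF.exists_isPresentedBy
    -- Index `0` is `F` itself: finding `M` takes only its vanishing on injectives. The other
    -- satellites serve to show that `M` has `G`-dimension zero.
    obtain ⟨M, ⟨e⟩⟩ := FunctorLinkage.exists_iso_ext_of_isPresentedBy F hF'
      ((FunctorLinkage.isInjectivelyStable_iff F).1 (h.right_injectivelyStable 0)) f hx
    exact ⟨M, (FunctorLinkage.hasGDimensionZero_iff_of_iso_ext hF' e).1 h, ⟨e⟩⟩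
  · rintro ⟨M, hM, ⟨e⟩⟩
    exact (FunctorLinkage.hasGDimensionZero_iff_of_iso_ext hF' e).2 hM
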